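/- Let $L\ge 0$ and $0=N_0\le N_1\le\dots\le N_L\le N_{L+1}=N$ be integers (in particular $0<N_1<\dots<N_L<N$ is allowed), and let $r_i>0$, $g_i>0$ $(1\le i\le L)$. For $1\le i\le L$ let $q_i(z)$ be an $N_i\times N_{i+1}$ matrix whose entries are entire functions of $z=x_1+ix_2\in\mathbb C$ (for instance polynomials), and put $q_0=0$. Let $\mathfrak D_i(z)$ be the $N_i\times N_i$ matrix formed by the first $N_i$ columns of $\xi_i(z)=q_i(z)q_{i+1}(z)\cdots q_L(z)$, and let $$\Omega_i^{\rm o}={\rm diag}\Big(\tfrac1{a_{1i}}\mathbf 1_{N_1-N_0},\tfrac1{a_{2i}}\mathbf 1_{N_2-N_1},\dots,\tfrac1{a_{ii}}\mathbf 1_{N_i-N_{i-1}}\Big),\qquad a_{ji}=\prod_{l=i}^{L}\Big(\sum_{m=j}^{l}r_m\Big).$$ Consider tuples $(\Omega_1,\dots,\Omega_L)$ of smooth maps $\Omega_i$ from $\mathbb C\cong\mathbb R^2$ to the positive definite Hermitian $N_i\times N_i$ matrices which, with $\Omega_{L+1}=\mathbf 1_N$, satisfy for $1\le i\le L$ the master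 equations $$q_i\,\Omega_{i+1}\,q_i^\dagger\,\Omega_i^{-1}-\Omega_i\,q_{i-1}^\dagger\,\Omega_{i-1}^{-1}\,q_{i-1}=r_i\mathbf 1_{N_i}-\frac4{g_i^2}\,\partial_{\bar z}\big(\partial_z\Omega_i\,\Omega_i^{-1}\big)\quad\text{on }\mathbb C$$ (the second term on the left being absent for $i=1$) and the boundary conditions $$\lim_{|z|\to\infty}\mathfrak D_i(z)^{-1}\,\Omega_i(z,\bar z)\,\mathfrak D_i(z)^{\dagger-1}=\Omega_i^{\rm o}.$$ For given $(q_1,\dots,q_L)$, $(r_i)$ and $(g_i)$ there is at most one such tuple: if $(\Omega_i)$ and $(\Omega_i')$ are two of them, then $\Omega_i(z)=\Omega_i'(z)$ for all $1\le i\le L$ and all $z\in\mathbb C$. -/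

import Mathlib

open Matrix Filter Topology
open scoped ContDiff ComplexOrder

noncomputable section

namespace VortexMaster

/-- The Wirtinger derivative `∂_z = (∂₁ - i ∂₂) / 2`, where `z = x₁ + i x₂`. -/
def dz (f : ℂ → ℂ) (z : ℂ) : ℂ :=
  (fderiv ℝ f z 1 - Complex.I * fderiv ℝ f z Complex.I) / 2

/-- The Wirtinger derivative `∂_{z̄} = (∂₁ + i ∂₂) / 2`. -/
def dzbar (f : ℂ → ℂ) (z : ℂ) : ℂ :=
  (fderiv ℝ f z 1 + Complex.I * fderiv ℝ f z Complex.I) / 2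

/-- Entrywise `∂_z` of a matrix-valued function. -/
def matDz {m n : ℕ} (F : ℂ → Matrix (Fin m) (Fin n) ℂ) (z : ℂ) : Matrix (Fin m) (Fin n) ℂ :=
  Matrix.of fun a b => dz (fun w => F w a b) z

/-- Entrywise `∂_{z̄}` of a matrix-valued function. -/
def matDzbar {m n : ℕ} (F : ℂ → Matrix (Fin m) (Fin n) ℂ) (z : ℂ) : Matrix (Fin m) (Fin n) ℂ :=
  Matrix.of fun a b => dzbar (fun w => F w a b) z

/-- The product `q_i(z) q_{i+1}(z) ⋯ q_{i+k-1}(z)`. -/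
def qProd {N : ℕ → ℕ} (q : (i : ℕ) → ℂ → Matrix (Fin (N i)) (Fin (N (i + 1))) ℂ)
    (z : ℂ) (i : ℕ) : (k : ℕ) → Matrix (Fin (N i)) (Fin (N (i + k))) ℂ
  | 0 => 1
  | k + 1 => qProd q z i k * q (i + k) z

/-- The matrix `ξ_i(z) = q_i(z) ⋯ q_L(z)` for `1 ≤ i ≤ L`; its number of columns is
`N_{i + (L + 1 - i)} = N_{L+1}`. -/
def xi {N : ℕ → ℕ} (q : (i : ℕ) → ℂ → Matrix (Fin (N i)) (Fin (N (i + 1))) ℂ)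
    (L i : ℕ) (z : ℂ) : Matrix (Fin (N i)) (Fin (N (i + (L + 1 - i)))) ℂ :=
  qProd q z i (L + 1 - i)

/-- The left `N_i × N_i` block `𝔇_i(z)` of `ξ_i(z)`. -/
def leftBlock {N : ℕ → ℕ} (hN : Monotone N)
    (q : (i : ℕ) → ℂ → Matrix (Fin (N i)) (Fin (N (i + 1))) ℂ)
    (L i : ℕ) (z : ℂ) : Matrix (Fin (N i)) (Fin (N i)) ℂ :=
  (xi q L i z).submatrix id (Fin.castLE (hN (Nat.le_add_right i (L + 1 - i))))

/-- The number `a_{j i} = ∏_{l=i}^{L} (∑_{m=j}^{l} r_m)`. -/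
def vacCoeff (r : ℕ → ℝ) (L j i : ℕ) : ℝ :=
  ∏ l ∈ Finset.Icc i L, ∑ m ∈ Finset.Icc j l, r m

/-- The vacuum matrix `Ω_i^o = diag(a_{1i}⁻¹ 1_{n_1}, …, a_{ii}⁻¹ 1_{n_i})`, `n_j = N_j - N_{j-1}`:
the (zero-based) index `b` lies in the `j`-th block exactly when `N_{j-1} ≤ b < N_j`. -/
def vacOmega (N : ℕ → ℕ) (r : ℕ → ℝ) (L i : ℕ) : Matrix (Fin (N i)) (Fin (N i)) ℂ :=
  Matrix.diagonal fun b =>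
    ∑ j ∈ Finset.Icc 1 i,
      if N (j - 1) ≤ (b : ℕ) ∧ (b : ℕ) < N j then (((vacCoeff r L j i)⁻¹ : ℝ) : ℂ) else 0

/-- The master equation at the node `i + 1`, holding on the whole plane:
`q_{i+1} Ω_{i+2} q_{i+1}† Ω_{i+1}⁻¹ - Ω_{i+1} q_i† Ω_i⁻¹ q_i`
`  = r_{i+1} 1 - (4 / g_{i+1}²) ∂_{z̄} (∂_z Ω_{i+1} Ω_{i+1}⁻¹)`.
For `i = 0` and `N 0 = 0` the second term on the left vanishes (a product through a
zero-dimensional space), which is the convention `q_0 = 0`. -/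
def MasterEquation {N : ℕ → ℕ} (q : (i : ℕ) → ℂ → Matrix (Fin (N i)) (Fin (N (i + 1))) ℂ)
    (g r : ℕ → ℝ) (Ω : (i : ℕ) → ℂ → Matrix (Fin (N i)) (Fin (N i)) ℂ) (i : ℕ) : Prop :=
  ∀ z : ℂ,
    q (i + 1) z * Ω (i + 2) z * (q (i + 1) z)ᴴ * (Ω (i + 1) z)⁻¹
        - Ω (i + 1) z * (q i z)ᴴ * (Ω i z)⁻¹ * q i z
      = ((r (i + 1) : ℝ) : ℂ) • (1 : Matrix (Fin (N (i + 1))) (Fin (N (i + 1))) ℂ)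
        - ((4 / g (i + 1) ^ 2 : ℝ) : ℂ) •
            matDzbar (fun w => matDz (Ω (i + 1)) w * (Ω (i + 1) w)⁻¹) z

/-- `Ω = (Ω_1, …, Ω_L)`, with `Ω_{L+1} = 1`, is a smooth positive definite Hermitian solution of
the master equations satisfying the boundary conditions at infinity. The components `Ω_0` (an empty
matrix) and `Ω_i` for `i > L + 1` play no role. -/
structure IsMasterSolution {N : ℕ → ℕ} (hN : Monotone N) (L : ℕ)
    (q : (i : ℕ) → ℂ → Matrix (Fin (N i)) (Fin (N (i + 1))) ℂ)
    (g r : ℕ → ℝ) (Ω : (i : ℕ) → ℂ → Matrix (Fin (N i)) (Fin (N i)) ℂ) : Prop where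
  last : ∀ z, Ω (L + 1) z = 1
  smooth : ∀ i, 1 ≤ i → i ≤ L → ∀ a b, ContDiff ℝ ∞ (fun z => Ω i z a b)
  posDef : ∀ i, 1 ≤ i → i ≤ L → ∀ z, (Ω i z).PosDef
  boundary : ∀ i, 1 ≤ i → i ≤ L →
    Tendsto (fun z => (leftBlock hN q L i z)⁻¹ * Ω i z * ((leftBlock hN q L i z)ᴴ)⁻¹)
      (cocompact ℂ) (𝓝 (vacOmega N r L i))
  master : ∀ i, i < L → MasterEquation q g r Ω i

end VortexMaster

end

/-! Two solutions are compared through the Donaldson distance `tr (X X'⁻¹) + tr (X' X⁻¹) - 2n`, a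
squared norm of `X - X'` that vanishes only when `X = X'`. Its weighted sum over the nodes, with
weights `4 / g_i²`, is shown to be subharmonic on the plane and to tend to zero at infinity, so the
maximum principle makes it vanish.

Subharmonicity has two sources. By `le_dzbar_dz_donaldsonDist`, applying `∂_{z̄} ∂_z` to one
distance gives at least a trace against the difference of the curvatures `∂_{z̄} (∂_z Ω Ω⁻¹)`. The
master equations turn the weighted traces into terms carried by the links `q_s`. Regrouped by link
instead of by node, these are sums of squares (`link_trace_nonneg`), and both ends of the chain
contribute nothing.

The decay follows from the boundary conditions: both solutions have the same invertible limit after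
conjugation by `𝔇_i⁻¹`, and `tr (X X'⁻¹)` is invariant under that conjugation. -/

noncomputable section

namespace VortexMaster

/-! ### Trace inequalities for positive definite matrices. -/

section Algebra

variable {m n : Type*} [Fintype m] [Fintype n]

open scoped MatrixOrder in
/-- For positive definite `P`, `Q` the form `tr (P M Q Mᴴ)` is the squared norm of a matrix which
vanishes only when `M` does. -/
theorem trace_mul_mul_mul_conjTranspose [DecidableEq m] [DecidableEq n] {P : Matrix m m ℂ}
    {Q : Matrix n n ℂ} (hP : P.PosDef) (hQ : Q.PosDef) (M : Matrix m n ℂ) :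
    0 ≤ (P * M * Q * Mᴴ).trace ∧ ((P * M * Q * Mᴴ).trace = 0 → M = 0) := by
  obtain ⟨B, hB, rfl⟩ := CStarAlgebra.isStrictlyPositive_iff_eq_star_mul_self.mp
    hP.isStrictlyPositive
  obtain ⟨C, hC, rfl⟩ := CStarAlgebra.isStrictlyPositive_iff_eq_star_mul_self.mp
    hQ.isStrictlyPositive
  -- With `P = Bᴴ B` and `Q = Cᴴ C`, the trace is the squared Frobenius norm of `B M Cᴴ`.
  have key : (star B * B * M * (star C * C) * Mᴴ).trace
      = ((B * M * Cᴴ) * (B * M * Cᴴ)ᴴ).trace := by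
    simp only [star_eq_conjTranspose, conjTranspose_mul, conjTranspose_conjTranspose]
    rw [Matrix.mul_assoc Bᴴ, Matrix.mul_assoc Bᴴ, Matrix.mul_assoc Bᴴ, trace_mul_comm]
    simp only [Matrix.mul_assoc]
  rw [key]
  refine ⟨(posSemidef_self_mul_conjTranspose _).trace_nonneg, fun h => ?_⟩
  rw [trace_mul_conjTranspose_self_eq_zero_iff] at h
  have hB' : IsUnit B.det := (isUnit_iff_isUnit_det B).1 hB
  have hC' : IsUnit (Cᴴ).det := (isUnit_iff_isUnit_det _).1 hC.star
  calc M = B⁻¹ * (B * M * Cᴴ) * (Cᴴ)⁻¹ := by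
        rw [Matrix.mul_assoc B, Matrix.nonsing_inv_mul_cancel_left _ _ hB',
          Matrix.mul_nonsing_inv_cancel_right _ _ hC']
    _ = 0 := by simp [h]

theorem PosDef.isUnit_det [DecidableEq n] {X : Matrix n n ℂ} (hX : X.PosDef) : IsUnit X.det :=
  (isUnit_iff_isUnit_det X).1 hX.isUnit

/-- The distance function `tr (X X'⁻¹) + tr (X' X⁻¹) - 2 n` on positive definite matrices. -/
def donaldsonDist [DecidableEq n] (X X' : Matrix n n ℂ) : ℂ :=
  (X * X'⁻¹).trace + (X' * X⁻¹).trace - 2 * Fintype.card n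

/-- Expanding the product leaves the two mixed traces and two copies of `-1`, one of them from `X⁻¹
X' X'⁻¹ X`. The squared-norm form yields both nonnegativity and definiteness. -/
theorem donaldsonDist_eq [DecidableEq n] {X X' : Matrix n n ℂ} (hX : X.PosDef) (hX' : X'.PosDef) :
    donaldsonDist X X' = (X⁻¹ * (X - X') * X'⁻¹ * (X - X')ᴴ).trace := by
  have h1 := Matrix.nonsing_inv_mul _ (PosDef.isUnit_det hX)
  have h2 := Matrix.nonsing_inv_mul _ (PosDef.isUnit_det hX')
  have e : X⁻¹ * (X - X') * X'⁻¹ * (X - X')ᴴ = X'⁻¹ * X + X⁻¹ * X' - 1 - X⁻¹ * X' * (X'⁻¹ * X) := by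
    rw [conjTranspose_sub, hX.isHermitian.eq, hX'.isHermitian.eq]
    simp only [Matrix.mul_sub, Matrix.sub_mul, h1, h2, Matrix.one_mul, Matrix.mul_assoc,
      Matrix.mul_one]
    abel
  have e2 : X⁻¹ * X' * (X'⁻¹ * X) = 1 := by
    rw [Matrix.mul_assoc, Matrix.mul_nonsing_inv_cancel_left _ _ (PosDef.isUnit_det hX'), h1]
  rw [e, e2, donaldsonDist]
  simp only [trace_sub, trace_add, trace_one, trace_mul_comm X', trace_mul_comm X]
  ring

theorem donaldsonDist_nonneg [DecidableEq n] {X X' : Matrix n n ℂ} (hX : X.PosDef)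
    (hX' : X'.PosDef) : 0 ≤ donaldsonDist X X' := by
  rw [donaldsonDist_eq hX hX']
  exact (trace_mul_mul_mul_conjTranspose hX.inv hX'.inv _).1

theorem eq_of_donaldsonDist_eq_zero [DecidableEq n] {X X' : Matrix n n ℂ} (hX : X.PosDef)
    (hX' : X'.PosDef) (h : donaldsonDist X X' = 0) : X = X' := by
  rw [donaldsonDist_eq hX hX'] at h
  exact sub_eq_zero.1 ((trace_mul_mul_mul_conjTranspose hX.inv hX'.inv _).2 h)

/-- The two contributions of a link `q` between neighbouring nodes combine to a sum of squares. -/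
theorem link_trace_nonneg [DecidableEq m] [DecidableEq n] {X X' : Matrix m m ℂ}
    {Y Y' : Matrix n n ℂ} (hX : X.PosDef) (hX' : X'.PosDef) (hY : Y.PosDef) (hY' : Y'.PosDef)
    (q : Matrix m n ℂ) :
    0 ≤ ((Y * qᴴ * X⁻¹ * q - Y' * qᴴ * X'⁻¹ * q) * (Y * Y'⁻¹ - Y' * Y⁻¹)).trace
      - ((q * Y * qᴴ * X⁻¹ - q * Y' * qᴴ * X'⁻¹) * (X * X'⁻¹ - X' * X⁻¹)).trace := by
  -- With `M = X⁻¹ q Y - X'⁻¹ q Y'`, the quantity equals `tr (X' M Y⁻¹ Mᴴ) + tr (X M Y'⁻¹ Mᴴ)`. The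
  -- identities `c1` to `c8` are the cyclic permutations that match the two expansions.
  have hM : (X⁻¹ * q * Y - X'⁻¹ * q * Y')ᴴ = Y * qᴴ * X⁻¹ - Y' * qᴴ * X'⁻¹ := by
    simp only [conjTranspose_sub, conjTranspose_mul, hX.inv.isHermitian.eq,
      hX'.inv.isHermitian.eq, hY.isHermitian.eq, hY'.isHermitian.eq, Matrix.mul_assoc]
  have p1 := (trace_mul_mul_mul_conjTranspose hX' hY.inv (X⁻¹ * q * Y - X'⁻¹ * q * Y')).1
  have p2 := (trace_mul_mul_mul_conjTranspose hX hY'.inv (X⁻¹ * q * Y - X'⁻¹ * q * Y')).1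
  rw [hM] at p1 p2
  refine (add_nonneg p1 p2).trans_eq ?_
  have uX := PosDef.isUnit_det hX
  have uX' := PosDef.isUnit_det hX'
  have uY := PosDef.isUnit_det hY
  have uY' := PosDef.isUnit_det hY'
  have c1 : (Y * (qᴴ * (X⁻¹ * (q * (Y * Y'⁻¹))))).trace
      = (q * (Y * (Y'⁻¹ * (Y * (qᴴ * X⁻¹))))).trace := by
    simpa only [Matrix.mul_assoc] using trace_mul_comm (Y * qᴴ * X⁻¹) (q * Y * Y'⁻¹)
  have c2 : (Y * (qᴴ * (X⁻¹ * (q * (Y' * Y⁻¹))))).trace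
      = (q * (Y' * (qᴴ * X⁻¹))).trace := by
    have := trace_mul_comm (Y * qᴴ * X⁻¹) (q * Y' * Y⁻¹)
    simpa only [Matrix.mul_assoc, Matrix.nonsing_inv_mul_cancel_left _ _ uY] using this
  have c3 : (Y' * (qᴴ * (X'⁻¹ * (q * (Y * Y'⁻¹))))).trace
      = (q * (Y * (qᴴ * X'⁻¹))).trace := by
    have := trace_mul_comm (Y' * qᴴ * X'⁻¹) (q * Y * Y'⁻¹)
    simpa only [Matrix.mul_assoc, Matrix.nonsing_inv_mul_cancel_left _ _ uY'] using this
  have c4 : (Y' * (qᴴ * (X'⁻¹ * (q * (Y' * Y⁻¹))))).trace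
      = (q * (Y' * (Y⁻¹ * (Y' * (qᴴ * X'⁻¹))))).trace := by
    simpa only [Matrix.mul_assoc] using trace_mul_comm (Y' * qᴴ * X'⁻¹) (q * Y' * Y⁻¹)
  have c5 : (q * (Y * (qᴴ * (X⁻¹ * (X' * X⁻¹))))).trace
      = (X' * (X⁻¹ * (q * (Y * (qᴴ * X⁻¹))))).trace := by
    simpa only [Matrix.mul_assoc] using trace_mul_comm (q * Y * qᴴ * X⁻¹) (X' * X⁻¹)
  have c6 : (q * (Y' * (qᴴ * (X'⁻¹ * (X * X'⁻¹))))).trace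
      = (X * (X'⁻¹ * (q * (Y' * (qᴴ * X'⁻¹))))).trace := by
    simpa only [Matrix.mul_assoc] using trace_mul_comm (q * Y' * qᴴ * X'⁻¹) (X * X'⁻¹)
  have c7 : (X' * (X⁻¹ * (q * (Y' * (qᴴ * X'⁻¹))))).trace = (q * (Y' * (qᴴ * X⁻¹))).trace := by
    have := trace_mul_comm (X' * X⁻¹) (q * Y' * qᴴ * X'⁻¹)
    simpa only [Matrix.mul_assoc, Matrix.nonsing_inv_mul_cancel_left _ _ uX'] using this
  have c8 : (X * (X'⁻¹ * (q * (Y * (qᴴ * X⁻¹))))).trace = (q * (Y * (qᴴ * X'⁻¹))).trace := by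
    have := trace_mul_comm (X * X'⁻¹) (q * Y * qᴴ * X⁻¹)
    simpa only [Matrix.mul_assoc, Matrix.nonsing_inv_mul_cancel_left _ _ uX] using this
  simp only [Matrix.mul_sub, Matrix.sub_mul, trace_sub, Matrix.mul_assoc,
    Matrix.nonsing_inv_mul_cancel_left _ _ uX, Matrix.nonsing_inv_mul_cancel_left _ _ uX',
    Matrix.nonsing_inv_mul_cancel_left _ _ uY, Matrix.nonsing_inv_mul_cancel_left _ _ uY',
    Matrix.mul_nonsing_inv_cancel_left _ _ uX, Matrix.mul_nonsing_inv_cancel_left _ _ uX',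
    Matrix.mul_nonsing_inv_cancel_left _ _ uY, Matrix.mul_nonsing_inv_cancel_left _ _ uY',
    c1, c2, c3, c4, c5, c6, c7, c8]
  ring

/-- If `W X Wᴴ` and `W X' Wᴴ` have the same invertible limit, then `tr (X X'⁻¹)` tends to the
dimension. -/
theorem tendsto_trace_mul_inv [DecidableEq n] {ι : Type*} {l : Filter ι}
    {W X X' : ι → Matrix n n ℂ} {V : Matrix n n ℂ} (hV : V.det ≠ 0)
    (h : Tendsto (fun z => W z * X z * (W z)ᴴ) l (𝓝 V))
    (h' : Tendsto (fun z => W z * X' z * (W z)ᴴ) l (𝓝 V)) :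
    Tendsto (fun z => (X z * (X' z)⁻¹).trace) l (𝓝 (Fintype.card n)) := by
  have hinv : ContinuousAt (Inv.inv : Matrix n n ℂ → Matrix n n ℂ) V := by
    refine continuousAt_matrix_inv V ?_
    rw [Ring.inverse_eq_inv']
    exact continuousAt_inv₀ hV
  have htr : Tendsto (fun z => (W z * X z * (W z)ᴴ * (W z * X' z * (W z)ᴴ)⁻¹).trace) l
      (𝓝 (V * V⁻¹).trace) :=
    ((continuous_id.matrix_trace).tendsto _).comp (h.mul (hinv.tendsto.comp h'))
  rw [Matrix.mul_nonsing_inv _ hV.isUnit, trace_one] at htr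
  refine htr.congr' ?_
  -- The limit forces `W` to be invertible eventually, because `det (W X Wᴴ)` tends to `det V ≠ 0`.
  -- From then on `W` cancels by conjugation under the trace.
  have hdet := ((continuous_id.matrix_det).tendsto V).comp h
  filter_upwards [hdet.eventually_ne hV] with z hz
  have hz' : (W z * X z * (W z)ᴴ).det ≠ 0 := hz
  rw [det_mul, det_mul] at hz'
  have hW : IsUnit (W z).det := (left_ne_zero_of_mul (left_ne_zero_of_mul hz')).isUnit
  have hWt : IsUnit ((W z)ᴴ).det := (right_ne_zero_of_mul hz').isUnit
  rw [Matrix.mul_inv_rev, Matrix.mul_inv_rev, Matrix.mul_assoc (W z * X z),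
    Matrix.mul_nonsing_inv_cancel_left _ _ hWt, Matrix.mul_assoc, trace_mul_comm,
    Matrix.mul_assoc, Matrix.mul_assoc, Matrix.nonsing_inv_mul _ hW, Matrix.mul_one]

end Algebra

/-! ### Maximum principle on the plane. -/

section MaximumPrinciple

/-- A positive second derivative would make the point a local minimum as well, so `f` would be
locally constant there and the second derivative zero. -/
theorem deriv_deriv_nonpos_of_isLocalMax {f : ℝ → ℝ} {x : ℝ} (hf : ContinuousAt f x)
    (h : IsLocalMax f x) : deriv (deriv f) x ≤ 0 := by
  by_contra! hpos
  have hmin := isLocalMin_of_deriv_deriv_pos hpos h.deriv_eq_zero hf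
  have hconst : f =ᶠ[𝓝 x] fun _ => f x := by
    filter_upwards [h, hmin] with y h1 h2 using le_antisymm h1 h2
  have := hconst.deriv.deriv_eq
  simp [this] at hpos

/-- The second derivative of `u` at `z` in the direction `v`. -/
def secondDeriv (u : ℂ → ℝ) (v z : ℂ) : ℝ := fderiv ℝ (fun w => fderiv ℝ u w v) z v

theorem secondDeriv_nonpos_of_isLocalMax {u : ℂ → ℝ} (hu : ContDiff ℝ 2 u) {z : ℂ}
    (h : IsLocalMax u z) (v : ℂ) : secondDeriv u v z ≤ 0 := by
  have hline (t : ℝ) : HasDerivAt (fun t : ℝ => z + t • v) v t := by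
    simpa using ((hasDerivAt_id t).smul_const v).const_add z
  have hd1 : deriv (fun t : ℝ => u (z + t • v)) = fun t => fderiv ℝ u (z + t • v) v := by
    ext t
    exact (((hu.differentiable (by norm_num)) _).hasFDerivAt.comp_hasDerivAt t (hline t)).deriv
  have hu' : Differentiable ℝ (fun w => fderiv ℝ u w v) :=
    ((hu.fderiv_right (m := 1) (by norm_num)).clm_apply contDiff_const).differentiable
      (by norm_num)
  have hd2 : deriv (deriv (fun t : ℝ => u (z + t • v))) 0 = secondDeriv u v z := by
    rw [hd1]
    have := ((hu' (z + (0 : ℝ) • v)).hasFDerivAt.comp_hasDerivAt 0 (hline 0)).deriv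
    simpa [secondDeriv, Function.comp_def] using this
  have hc : Continuous (fun t : ℝ => z + t • v) := by fun_prop
  rw [← hd2]
  refine deriv_deriv_nonpos_of_isLocalMax (hu.continuous.comp hc).continuousAt ?_
  have : Tendsto (fun t : ℝ => z + t • v) (𝓝 0) (𝓝 z) := by
    simpa using hc.tendsto 0
  have h2 := this.eventually h
  filter_upwards [h2] with t ht
  simpa using ht

theorem secondDeriv_add {u w : ℂ → ℝ} (hu : ContDiff ℝ 2 u) (hw : ContDiff ℝ 2 w) (v z : ℂ) :
    secondDeriv (fun x => u x + w x) v z = secondDeriv u v z + secondDeriv w v z := by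
  have d {u : ℂ → ℝ} (hu : ContDiff ℝ 2 u) : Differentiable ℝ (fun w => fderiv ℝ u w v) :=
    ((hu.fderiv_right (m := 1) (by norm_num)).clm_apply contDiff_const).differentiable
      (by norm_num)
  have e : (fun x => fderiv ℝ (fun x => u x + w x) x v)
      = fun x => fderiv ℝ u x v + fderiv ℝ w x v := by
    ext x
    rw [fderiv_fun_add (hu.differentiable (by norm_num) x) (hw.differentiable (by norm_num) x)]
    rfl
  rw [secondDeriv, e, fderiv_fun_add (d hu z) (d hw z)]
  rfl

theorem secondDeriv_mul_norm_sq (ε : ℝ) (v z : ℂ) :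
    secondDeriv (fun w => ε * ‖w‖ ^ 2) v z = 2 * ε * ‖v‖ ^ 2 := by
  have e (w : ℂ) : HasFDerivAt (fun w : ℂ => ε * ‖w‖ ^ 2) (ε • (2 • innerSL ℝ w)) w :=
    (hasStrictFDerivAt_norm_sq w).hasFDerivAt.const_mul ε
  have e1 : (fun w : ℂ => fderiv ℝ (fun w : ℂ => ε * ‖w‖ ^ 2) w v)
      = fun w => (2 * ε) * innerSL ℝ v w := by
    ext w
    rw [(e w).fderiv]
    simp only [_root_.smul_apply, innerSL_apply_apply, real_inner_comm, smul_eq_mul,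
      nsmul_eq_mul]
    push_cast; ring
  rw [secondDeriv, e1, ((innerSL ℝ v).hasFDerivAt.const_mul (2 * ε)).fderiv]
  simp

/-- Maximum principle: a subharmonic function on the plane vanishing at infinity is nonpositive. -/
theorem nonpos_of_laplacian_nonneg {u : ℂ → ℝ} (hu : ContDiff ℝ 2 u)
    (hL : ∀ z, 0 ≤ secondDeriv u 1 z + secondDeriv u Complex.I z)
    (hlim : Tendsto u (cocompact ℂ) (𝓝 0)) (z : ℂ) : u z ≤ 0 := by
  by_contra! hz
  obtain ⟨R, hR⟩ : ∃ R : ℝ, ∀ w : ℂ, R < ‖w‖ → u w < u z / 2 := by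
    have h1 : ∀ᶠ w in cocompact ℂ, u w < u z / 2 := hlim.eventually_lt_const (by linarith)
    rw [← Metric.cobounded_eq_cocompact, ← comap_norm_atTop, eventually_comap] at h1
    obtain ⟨R, hR⟩ := h1.exists_forall_of_atTop
    exact ⟨R, fun w hw => hR _ hw.le w rfl⟩
  set ρ := max (R + 1) (‖z‖ + 1) with hρ
  have hρ0 : 0 < ρ := lt_of_lt_of_le (by positivity) (le_max_right _ _)
  -- The perturbation `ε ‖w‖²` equals `u z / 4` on the circle of radius `ρ`, where `u < u z / 2`.
  -- The perturbed function is therefore below `u z` on the circle and its maximum over the disc is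
  -- interior. There its Laplacian is nonpositive, yet at least `4 ε > 0`.
  set ε := u z / (4 * ρ ^ 2) with hε
  have hε0 : 0 < ε := by positivity
  have hερ : ε * ρ ^ 2 = u z / 4 := by rw [hε]; field_simp
  have hsq : ContDiff ℝ 2 (fun w : ℂ => ε * ‖w‖ ^ 2) := contDiff_const.mul (contDiff_norm_sq ℝ)
  have hF : ContDiff ℝ 2 (fun w => u w + ε * ‖w‖ ^ 2) := hu.add hsq
  obtain ⟨w, hw, hmax⟩ := (isCompact_closedBall (0 : ℂ) ρ).exists_isMaxOn
    ⟨0, by simp [hρ0.le]⟩ hF.continuous.continuousOn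
  have hzρ : ‖z‖ < ρ := lt_of_lt_of_le (by linarith) (le_max_right _ _)
  have hzw : u z + ε * ‖z‖ ^ 2 ≤ u w + ε * ‖w‖ ^ 2 := hmax (by simpa using hzρ.le)
  have hwρ : ‖w‖ < ρ := by
    refine lt_of_le_of_ne (by simpa using hw) fun heq => ?_
    have h1 : u w < u z / 2 := hR w (by
      rw [heq]
      exact lt_of_lt_of_le (by linarith) (le_max_left _ _))
    rw [heq, hερ] at hzw
    nlinarith [mul_nonneg hε0.le (sq_nonneg ‖z‖)]
  have hloc : IsLocalMax (fun w => u w + ε * ‖w‖ ^ 2) w :=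
    hmax.isLocalMax (Metric.closedBall_mem_nhds_of_mem (by simpa using hwρ))
  have s1 := secondDeriv_nonpos_of_isLocalMax hF hloc 1
  have s2 := secondDeriv_nonpos_of_isLocalMax hF hloc Complex.I
  rw [secondDeriv_add hu hsq, secondDeriv_mul_norm_sq] at s1 s2
  simp only [norm_one, Complex.norm_I] at s1 s2
  linarith [hL w]

/-- A nonnegative function `f` on the plane with `∂_{z̄} ∂_z f ≥ 0` which vanishes at infinity is
zero. -/
theorem eq_zero_of_dzbar_dz_nonneg {f : ℂ → ℂ} (hf : ContDiff ℝ ∞ f) (h0 : ∀ z, 0 ≤ f z)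
    (hL : ∀ z, 0 ≤ dzbar (dz f) z) (hlim : Tendsto f (cocompact ℂ) (𝓝 0)) (z : ℂ) : f z = 0 := by
  set u : ℂ → ℝ := fun w => (f w).re with hu_def
  -- In the order on `ℂ`, `0 ≤ f w` also says that `f w` is real.
  have hfu : f = fun w => ((u w : ℝ) : ℂ) := by
    ext w
    exact Complex.ext (by simp [hu_def]) (by simpa using (Complex.nonneg_iff.1 (h0 w)).2.symm)
  have hu : ContDiff ℝ 2 u := by
    have : ContDiff ℝ 2 f := contDiff_infty.1 hf 2
    exact Complex.reCLM.contDiff.comp this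
  have hd {v : ℂ → ℝ} {w : ℂ} (hv : DifferentiableAt ℝ v w) (e : ℂ) :
      fderiv ℝ (fun x => ((v x : ℝ) : ℂ)) w e = ((fderiv ℝ v w e : ℝ) : ℂ) := by
    have := (Complex.ofRealCLM.hasFDerivAt.comp w hv.hasFDerivAt).fderiv
    simpa [Function.comp_def] using congrArg (fun T => T e) this
  have hdu (e : ℂ) : Differentiable ℝ (fun w => fderiv ℝ u w e) :=
    ((hu.fderiv_right (m := 1) (by norm_num)).clm_apply contDiff_const).differentiable
      (by norm_num)
  have hdz : dz f = fun w => (((fderiv ℝ u w 1 / 2 : ℝ) : ℂ)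
      + (-Complex.I) * ((fderiv ℝ u w Complex.I / 2 : ℝ) : ℂ)) := by
    ext w
    rw [dz, hfu, hd (hu.differentiable (by norm_num) w), hd (hu.differentiable (by norm_num) w)]
    push_cast; ring
  have hd2 (w e : ℂ) : fderiv ℝ (dz f) w e = ((fderiv ℝ (fun x => fderiv ℝ u x 1) w e / 2 : ℝ) : ℂ)
      + (-Complex.I) * ((fderiv ℝ (fun x => fderiv ℝ u x Complex.I) w e / 2 : ℝ) : ℂ) := by
    have d1 : DifferentiableAt ℝ (fun w => fderiv ℝ u w 1 / 2) w := by
      simpa only [div_eq_mul_inv] using (hdu 1 w).mul_const (2 : ℝ)⁻¹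
    have d2 : DifferentiableAt ℝ (fun w => fderiv ℝ u w Complex.I / 2) w :=
      by
      simpa only [div_eq_mul_inv] using (hdu Complex.I w).mul_const (2 : ℝ)⁻¹
    have d1' : DifferentiableAt ℝ (fun x => ((fderiv ℝ u x 1 / 2 : ℝ) : ℂ)) w :=
      Complex.ofRealCLM.differentiableAt.comp w d1
    have d2' : DifferentiableAt ℝ (fun x => ((fderiv ℝ u x Complex.I / 2 : ℝ) : ℂ)) w :=
      Complex.ofRealCLM.differentiableAt.comp w d2
    have half (c : ℂ) : fderiv ℝ (fun x => fderiv ℝ u x c / 2) w e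
        = fderiv ℝ (fun x => fderiv ℝ u x c) w e / 2 := by
      simp only [div_eq_mul_inv]
      rw [fderiv_mul_const (hdu c w)]
      simp [mul_comm]
    rw [hdz, fderiv_fun_add d1' (d2'.const_mul _), fderiv_const_mul d2', _root_.add_apply,
      _root_.smul_apply, smul_eq_mul, hd d1, hd d2, half, half]
  -- The mixed second derivatives enter only the imaginary part, so their symmetry is not needed
  -- here.
  have hre (w : ℂ) : (dzbar (dz f) w).re
      = (secondDeriv u 1 w + secondDeriv u Complex.I w) / 4 := by
    rw [dzbar, hd2, hd2]
    simp [secondDeriv]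
    ring
  have hle : u z ≤ 0 := by
    refine nonpos_of_laplacian_nonneg hu (fun w => ?_) ?_ z
    · have := (Complex.nonneg_iff.1 (hL w)).1
      rw [hre] at this
      linarith
    · simpa [Function.comp_def] using (Complex.continuous_re.tendsto 0).comp hlim
  have hge : 0 ≤ u z := (Complex.nonneg_iff.1 (h0 z)).1
  rw [hfu]
  simp [le_antisymm hle hge]

end MaximumPrinciple

/-! ### Calculus of the scalar Wirtinger operators. -/

section Wirtinger

/-- The operator `(∂₁ + c ∂₂) / 2`; `c = -i` and `c = i` give `∂_z` and `∂_{z̄}`. -/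
def wirt (c : ℂ) (f : ℂ → ℂ) (z : ℂ) : ℂ :=
  (fderiv ℝ f z 1 + c * fderiv ℝ f z Complex.I) / 2

theorem dz_eq_wirt (f : ℂ → ℂ) : dz f = wirt (-Complex.I) f := by
  ext z; simp [dz, wirt, sub_eq_add_neg]

theorem dzbar_eq_wirt (f : ℂ → ℂ) : dzbar f = wirt Complex.I f := rfl

variable {c : ℂ} {f g : ℂ → ℂ} {z : ℂ}

theorem wirt_mul (hf : DifferentiableAt ℝ f z) (hg : DifferentiableAt ℝ g z) :
    wirt c (fun w => f w * g w) z = wirt c f z * g z + f z * wirt c g z := by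
  simp only [wirt, fderiv_fun_mul hf hg, _root_.add_apply, _root_.smul_apply,
    smul_eq_mul]
  ring

theorem wirt_add (hf : DifferentiableAt ℝ f z) (hg : DifferentiableAt ℝ g z) :
    wirt c (fun w => f w + g w) z = wirt c f z + wirt c g z := by
  simp only [wirt, fderiv_fun_add hf hg, _root_.add_apply]
  ring

theorem wirt_sub (hf : DifferentiableAt ℝ f z) (hg : DifferentiableAt ℝ g z) :
    wirt c (fun w => f w - g w) z = wirt c f z - wirt c g z := by
  simp only [wirt, fderiv_fun_sub hf hg, _root_.sub_apply]
  ring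

theorem wirt_const (a : ℂ) : wirt c (fun _ => a) z = 0 := by
  simp [wirt]

theorem wirt_sum {ι : Type*} (s : Finset ι) {F : ι → ℂ → ℂ}
    (hF : ∀ i ∈ s, DifferentiableAt ℝ (F i) z) :
    wirt c (fun w => ∑ i ∈ s, F i w) z = ∑ i ∈ s, wirt c (F i) z := by
  simp only [wirt, fderiv_fun_sum hF, _root_.sum_apply, Finset.mul_sum,
    ← Finset.sum_add_distrib, Finset.sum_div]

theorem wirt_star (hf : DifferentiableAt ℝ f z) :
    wirt (star c) (fun w => star (f w)) z = star (wirt c f z) := by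
  have h (v : ℂ) : fderiv ℝ (fun w => star (f w)) z v = star (fderiv ℝ f z v) := by
    have := (Complex.conjCLE.toContinuousLinearMap.hasFDerivAt.comp z hf.hasFDerivAt).fderiv
    simpa [Function.comp_def] using congrArg (fun T => T v) this
  simp only [wirt, h]
  simp

theorem ContDiff.wirt (hf : ContDiff ℝ ∞ f) : ContDiff ℝ ∞ (wirt c f) := by
  have h (v : ℂ) : ContDiff ℝ ∞ (fun z => fderiv ℝ f z v) :=
    (hf.fderiv_right (m := ∞) le_rfl).clm_apply contDiff_const
  exact ((h 1).add (contDiff_const.mul (h Complex.I))).div_const 2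

end Wirtinger

/-! ### Matrix Wirtinger calculus and subharmonicity of the Donaldson distance. -/

section MatrixWirtinger

/-- Entrywise smoothness of a matrix-valued function. -/
def MatSmooth {m n : ℕ} (F : ℂ → Matrix (Fin m) (Fin n) ℂ) : Prop :=
  ∀ a b, ContDiff ℝ ∞ fun z => F z a b

/-- Entrywise `wirt`. -/
def matWirt (c : ℂ) {m n : ℕ} (F : ℂ → Matrix (Fin m) (Fin n) ℂ) (z : ℂ) :
    Matrix (Fin m) (Fin n) ℂ :=
  Matrix.of fun a b => wirt c (fun w => F w a b) z

variable {m n k : ℕ} {c z : ℂ} {F F' : ℂ → Matrix (Fin m) (Fin n) ℂ}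
  {G : ℂ → Matrix (Fin n) (Fin k) ℂ} {X X' : ℂ → Matrix (Fin n) (Fin n) ℂ}

theorem matDz_eq_matWirt (F : ℂ → Matrix (Fin m) (Fin n) ℂ) :
    matDz F = matWirt (-Complex.I) F := by
  ext z a b; simp [matDz, matWirt, dz_eq_wirt]

theorem matDzbar_eq_matWirt (F : ℂ → Matrix (Fin m) (Fin n) ℂ) :
    matDzbar F = matWirt Complex.I F := rfl

theorem MatSmooth.differentiableAt (hF : MatSmooth F) (a : Fin m) (b : Fin n) (z : ℂ) :
    DifferentiableAt ℝ (fun z => F z a b) z :=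
  (hF a b).differentiable (by simp) z

theorem MatSmooth.wirt (hF : MatSmooth F) : MatSmooth (matWirt c F) := fun a b =>
  ContDiff.wirt (hF a b)

theorem MatSmooth.mul (hF : MatSmooth F) (hG : MatSmooth G) :
    MatSmooth fun z => F z * G z := fun a b => by
  simp only [Matrix.mul_apply]
  exact ContDiff.sum fun j _ => (hF a j).mul (hG j b)

theorem MatSmooth.trace (hX : MatSmooth X) : ContDiff ℝ ∞ fun z => (X z).trace := by
  simp only [Matrix.trace, Matrix.diag]
  exact ContDiff.sum fun j _ => hX j j

theorem MatSmooth.det (hX : MatSmooth X) : ContDiff ℝ ∞ fun z => (X z).det := by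
  simp only [Matrix.det_apply']
  exact ContDiff.sum fun σ _ => contDiff_const.mul (contDiff_prod fun j _ => hX _ j)

theorem MatSmooth.inv (hX : MatSmooth X) (h : ∀ z, (X z).det ≠ 0) :
    MatSmooth fun z => (X z)⁻¹ := fun a b => by
  simp only [Matrix.inv_def, Matrix.smul_apply, Ring.inverse_eq_inv', smul_eq_mul,
    Matrix.adjugate_apply]
  refine (hX.det.inv h).mul (MatSmooth.det fun i j => ?_)
  -- Cofactors are determinants of `X` with one row replaced by a constant unit vector; that row is
  -- treated separately.
  by_cases hi : i = b
  · subst hi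
    simpa using contDiff_const
  · simpa [Matrix.updateRow_ne hi] using hX i j

theorem matWirt_mul (hF : MatSmooth F) (hG : MatSmooth G) :
    matWirt c (fun w => F w * G w) z = matWirt c F z * G z + F z * matWirt c G z := by
  ext a b
  simp only [matWirt, Matrix.add_apply, Matrix.mul_apply, Matrix.of_apply]
  rw [wirt_sum _ fun j _ => (hF.differentiableAt a j z).fun_mul (hG.differentiableAt j b z),
    ← Finset.sum_add_distrib]
  exact Finset.sum_congr rfl fun j _ =>
    wirt_mul (hF.differentiableAt a j z) (hG.differentiableAt j b z)

theorem matWirt_sub (hF : MatSmooth F) (hF' : MatSmooth F') :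
    matWirt c (fun w => F w - F' w) z = matWirt c F z - matWirt c F' z := by
  ext a b
  exact wirt_sub (hF.differentiableAt a b z) (hF'.differentiableAt a b z)

theorem wirt_trace (hX : MatSmooth X) :
    wirt c (fun w => (X w).trace) z = (matWirt c X z).trace :=
  wirt_sum _ fun j _ => hX.differentiableAt j j z

/-- For `c = -i` this gives `∂_{z̄} X = (∂_z X)ᴴ`, so one connection matrix governs both derivatives
of a Hermitian `X`. -/
theorem matWirt_star (hX : MatSmooth X) (h : ∀ z, (X z).IsHermitian) :
    matWirt (star c) X z = (matWirt c X z)ᴴ := by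
  ext a b
  have e : (fun w => X w a b) = fun w => star (X w b a) := by
    ext w
    conv_lhs => rw [← (h w).eq]
    rfl
  simp only [matWirt, Matrix.of_apply, Matrix.conjTranspose_apply]
  rw [e, wirt_star (hX.differentiableAt b a z)]

theorem matWirt_inv (hX : MatSmooth X) (h : ∀ z, (X z).det ≠ 0) :
    matWirt c (fun w => (X w)⁻¹) z = -((X z)⁻¹ * matWirt c X z * (X z)⁻¹) := by
  have e : (fun w => X w * (X w)⁻¹) = fun _ => 1 := by
    ext1 w
    exact Matrix.mul_nonsing_inv _ (h w).isUnit
  have h0 : matWirt c (fun w => X w * (X w)⁻¹) z = 0 := by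
    rw [e]
    ext a b
    exact wirt_const _
  rw [matWirt_mul hX (hX.inv h)] at h0
  have h1 := congrArg (fun T => (X z)⁻¹ * T) h0
  simp only [Matrix.mul_add, Matrix.nonsing_inv_mul_cancel_left _ _ (h z).isUnit,
    Matrix.mul_zero] at h1
  rw [eq_neg_iff_add_eq_zero, add_comm, Matrix.mul_assoc]
  exact h1

/-- The connection matrix `∂_z X X⁻¹`. -/
def conn (X : ℂ → Matrix (Fin n) (Fin n) ℂ) (z : ℂ) : Matrix (Fin n) (Fin n) ℂ :=
  matDz X z * (X z)⁻¹

theorem MatSmooth.conn (hX : MatSmooth X) (h : ∀ z, (X z).det ≠ 0) : MatSmooth (conn X) := by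
  unfold VortexMaster.conn
  rw [matDz_eq_matWirt]
  exact hX.wirt.mul (hX.inv h)

/-- Write `A`, `A'` for the connections and `h = X X'⁻¹`. From `∂_z X = A X` and `∂_{z̄} X = X Aᴴ`
come `∂_z h = A h - h A'` and `∂_{z̄} h = X (A - A')ᴴ X'⁻¹`. Differentiating `tr (A h - h A')` gives
a curvature term and `tr ((A - A') ∂_{z̄} h)`, which is a square by cyclicity. -/
theorem dzbar_dz_trace_mul_inv (hX : MatSmooth X) (hX' : MatSmooth X') (pX : ∀ z, (X z).PosDef)
    (pX' : ∀ z, (X' z).PosDef) (z : ℂ) :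
    dzbar (dz fun w => (X w * (X' w)⁻¹).trace) z
      = ((matDzbar (conn X) z - matDzbar (conn X') z) * (X z * (X' z)⁻¹)).trace
        + ((X' z)⁻¹ * (conn X z - conn X' z) * X z * (conn X z - conn X' z)ᴴ).trace := by
  have dX z : (X z).det ≠ 0 := (PosDef.isUnit_det (pX z)).ne_zero
  have dX' z : (X' z).det ≠ 0 := (PosDef.isUnit_det (pX' z)).ne_zero
  have sA := hX.conn dX
  have sA' := hX'.conn dX'
  have sh : MatSmooth fun w => X w * (X' w)⁻¹ := hX.mul (hX'.inv dX')
  have a1 {X : ℂ → Matrix (Fin n) (Fin n) ℂ} (dX : ∀ z, (X z).det ≠ 0) w :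
      matWirt (-Complex.I) X w = conn X w * X w := by
    rw [conn, Matrix.nonsing_inv_mul_cancel_right _ _ (dX w).isUnit, matDz_eq_matWirt]
  have a2 {X : ℂ → Matrix (Fin n) (Fin n) ℂ} (hX : MatSmooth X) (pX : ∀ z, (X z).PosDef)
      (dX : ∀ z, (X z).det ≠ 0) w : matWirt Complex.I X w = X w * (conn X w)ᴴ := by
    have := matWirt_star (c := -Complex.I) (z := w) hX fun z => (pX z).isHermitian
    rw [a1 dX, conjTranspose_mul, (pX w).isHermitian.eq] at this
    simpa using this
  have d1 w : matWirt (-Complex.I) (fun w => X w * (X' w)⁻¹) w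
      = conn X w * (X w * (X' w)⁻¹) - X w * (X' w)⁻¹ * conn X' w := by
    rw [matWirt_mul hX (hX'.inv dX'), matWirt_inv hX' dX', a1 dX, a1 dX']
    rw [← Matrix.mul_assoc (X' w)⁻¹, Matrix.mul_nonsing_inv_cancel_right _ _ (dX' w).isUnit]
    simp only [Matrix.mul_assoc, Matrix.mul_neg, sub_eq_add_neg]
  have d2 : matWirt Complex.I (fun w => X w * (X' w)⁻¹) z
      = X z * (conn X z - conn X' z)ᴴ * (X' z)⁻¹ := by
    rw [matWirt_mul hX (hX'.inv dX'), matWirt_inv hX' dX', a2 hX pX dX, a2 hX' pX' dX']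
    rw [Matrix.nonsing_inv_mul_cancel_left _ _ (dX' z).isUnit]
    simp only [conjTranspose_sub, Matrix.mul_sub, Matrix.sub_mul, Matrix.mul_assoc,
      Matrix.mul_neg, ← sub_eq_add_neg]
  have e1 : (dz fun w => (X w * (X' w)⁻¹).trace)
      = fun w => (conn X w * (X w * (X' w)⁻¹) - X w * (X' w)⁻¹ * conn X' w).trace := by
    ext w
    rw [dz_eq_wirt, wirt_trace sh, d1]
  have s1 := sA.mul sh
  have s2 := sh.mul sA'
  have s3 : MatSmooth fun w => conn X w * (X w * (X' w)⁻¹) - X w * (X' w)⁻¹ * conn X' w :=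
    fun a b => (s1 a b).sub (s2 a b)
  rw [e1, dzbar_eq_wirt, wirt_trace s3, matWirt_sub s1 s2, matWirt_mul sA sh, matWirt_mul sh sA',
    d2, matDzbar_eq_matWirt, matDzbar_eq_matWirt]
  simp only [Matrix.sub_mul, Matrix.mul_sub, trace_sub, trace_add]
  have c1 := trace_mul_comm (matWirt Complex.I (conn X') z) (X z * (X' z)⁻¹)
  have c2 (B : Matrix (Fin n) (Fin n) ℂ) :
      ((X' z)⁻¹ * conn X z * X z * B).trace = (conn X z * (X z * B * (X' z)⁻¹)).trace := by
    rw [Matrix.mul_assoc, Matrix.mul_assoc, trace_mul_comm]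
    simp only [Matrix.mul_assoc]
  have c3 (B : Matrix (Fin n) (Fin n) ℂ) :
      ((X' z)⁻¹ * conn X' z * X z * B).trace = (X z * B * (X' z)⁻¹ * conn X' z).trace := by
    rw [Matrix.mul_assoc, trace_mul_comm]
    simp only [Matrix.mul_assoc]
  simp only [c1, c2, c3, conjTranspose_sub, Matrix.mul_sub, Matrix.sub_mul, trace_sub]
  ring

theorem contDiff_donaldsonDist (hX : MatSmooth X) (hX' : MatSmooth X') (pX : ∀ z, (X z).PosDef)
    (pX' : ∀ z, (X' z).PosDef) : ContDiff ℝ ∞ fun w => donaldsonDist (X w) (X' w) := by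
  have dX z : (X z).det ≠ 0 := (PosDef.isUnit_det (pX z)).ne_zero
  have dX' z : (X' z).det ≠ 0 := (PosDef.isUnit_det (pX' z)).ne_zero
  exact ((hX.mul (hX'.inv dX')).trace.add (hX'.mul (hX.inv dX)).trace).sub contDiff_const

/-- The Donaldson distance is subharmonic up to a term measuring the difference of curvatures. -/
theorem le_dzbar_dz_donaldsonDist (hX : MatSmooth X) (hX' : MatSmooth X')
    (pX : ∀ z, (X z).PosDef) (pX' : ∀ z, (X' z).PosDef) (z : ℂ) :
    ((matDzbar (conn X) z - matDzbar (conn X') z)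
        * (X z * (X' z)⁻¹ - X' z * (X z)⁻¹)).trace
      ≤ dzbar (dz fun w => donaldsonDist (X w) (X' w)) z := by
  have dX z : (X z).det ≠ 0 := (PosDef.isUnit_det (pX z)).ne_zero
  have dX' z : (X' z).det ≠ 0 := (PosDef.isUnit_det (pX' z)).ne_zero
  have s1 := (hX.mul (hX'.inv dX')).trace
  have s2 := (hX'.mul (hX.inv dX)).trace
  have d {f : ℂ → ℂ} (hf : ContDiff ℝ ∞ f) : Differentiable ℝ f := hf.differentiable (by simp)
  have e : (dz fun w => donaldsonDist (X w) (X' w))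
      = fun w => dz (fun w => (X w * (X' w)⁻¹).trace) w
        + dz (fun w => (X' w * (X w)⁻¹).trace) w := by
    ext w
    simp only [dz_eq_wirt, donaldsonDist]
    rw [wirt_sub ((d s1 w).fun_add (d s2 w)) (differentiableAt_const _), wirt_const,
      wirt_add (d s1 w) (d s2 w), sub_zero]
  have e2 : dzbar (dz fun w => donaldsonDist (X w) (X' w)) z
      = dzbar (dz fun w => (X w * (X' w)⁻¹).trace) z
        + dzbar (dz fun w => (X' w * (X w)⁻¹).trace) z := by
    rw [e, dzbar_eq_wirt, dzbar_eq_wirt, dzbar_eq_wirt]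
    simp only [dz_eq_wirt]
    exact wirt_add (d (ContDiff.wirt s1) z) (d (ContDiff.wirt s2) z)
  rw [e2, dzbar_dz_trace_mul_inv hX hX' pX pX', dzbar_dz_trace_mul_inv hX' hX pX' pX]
  have p1 := (trace_mul_mul_mul_conjTranspose (pX' z).inv (pX z) (conn X z - conn X' z)).1
  have p2 := (trace_mul_mul_mul_conjTranspose (pX z).inv (pX' z) (conn X' z - conn X z)).1
  -- The squares `p1` and `p2` are dropped. Exchanging `X` and `X'` flips the sign of the curvature
  -- difference, which produces the factor `X X'⁻¹ - X' X⁻¹`.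
  refine (le_add_of_nonneg_right (add_nonneg p1 p2)).trans_eq ?_
  rw [Matrix.mul_sub, trace_sub, ← neg_sub (matDzbar (conn X') z), Matrix.neg_mul,
    Matrix.neg_mul, trace_neg, trace_neg]
  ring

end MatrixWirtinger

/-! ### Invertibility of the vacuum matrix. -/

section Vacuum

theorem vacCoeff_pos {r : ℕ → ℝ} {L i j : ℕ} (hr : ∀ i, 1 ≤ i → i ≤ L → 0 < r i) (hj : 1 ≤ j)
    (hji : j ≤ i) : 0 < vacCoeff r L j i := by
  refine Finset.prod_pos fun l hl => Finset.sum_pos (fun m hm => ?_) ?_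
  · rw [Finset.mem_Icc] at hl hm
    exact hr m (hj.trans hm.1) (hm.2.trans hl.2)
  · rw [Finset.mem_Icc] at hl
    exact Finset.nonempty_Icc.2 (hji.trans hl.1)

theorem det_vacOmega_ne_zero {N : ℕ → ℕ} {r : ℕ → ℝ} {L : ℕ} (hN0 : N 0 = 0) (hN : Monotone N)
    (hr : ∀ i, 1 ≤ i → i ≤ L → 0 < r i) (i : ℕ) : (vacOmega N r L i).det ≠ 0 := by
  rw [vacOmega, det_diagonal]
  refine Finset.prod_ne_zero_iff.2 fun b _ => ?_
  -- The block containing `b` is the first `j` with `b < N j`. Blocks may be empty, but exactly one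
  -- contains `b`, so the sum in the diagonal entry has a single nonzero term.
  have hex : ∃ j, (b : ℕ) < N j := ⟨i, b.2⟩
  have hj1 : 1 ≤ Nat.find hex := by
    rw [Nat.one_le_iff_ne_zero]
    intro h0
    have := Nat.find_spec hex
    rw [h0, hN0] at this
    exact absurd this (Nat.not_lt_zero _)
  have hji : Nat.find hex ≤ i := Nat.find_min' hex b.2
  have hlow : N (Nat.find hex - 1) ≤ b :=
    not_lt.1 (Nat.find_min hex (Nat.sub_lt hj1 one_pos))
  rw [Finset.sum_eq_single_of_mem _ (Finset.mem_Icc.2 ⟨hj1, hji⟩), if_pos ⟨hlow, Nat.find_spec hex⟩]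
  · exact_mod_cast (inv_pos.2 (vacCoeff_pos hr hj1 hji)).ne'
  · intro j hj hne
    refine if_neg fun h => hne (le_antisymm ?_ (Nat.find_min' hex h.2))
    by_contra! hlt
    have := (Nat.find_spec hex).trans_le (hN (Nat.le_sub_one_of_lt hlt))
    omega

end Vacuum

/-! ### Summation over the chain and uniqueness. -/

section Uniqueness

variable {N : ℕ → ℕ} {hN : Monotone N} {L : ℕ}
  {q : (i : ℕ) → ℂ → Matrix (Fin (N i)) (Fin (N (i + 1))) ℂ} {g r : ℕ → ℝ}
  {Ω Ω' : (i : ℕ) → ℂ → Matrix (Fin (N i)) (Fin (N i)) ℂ}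

/-- Adding the end nodes `0` (an empty matrix) and `L + 1` (the identity) lets `link_trace_nonneg`
apply to every link `q_0, …, q_L`. -/
theorem IsMasterSolution.posDef_of_le (h : IsMasterSolution hN L q g r Ω) (hN0 : N 0 = 0) {i : ℕ}
    (hi : i ≤ L + 1) (z : ℂ) : (Ω i z).PosDef := by
  rcases Nat.eq_zero_or_pos i with rfl | hpos
  · have : IsEmpty (Fin (N 0)) := by rw [hN0]; infer_instance
    rw [Subsingleton.elim (Ω 0 z) 1]
    exact Matrix.PosDef.one
  · rcases Nat.lt_or_ge L i with hlt | hle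
    · obtain rfl : i = L + 1 := le_antisymm hi hlt
      rw [h.last z]
      exact Matrix.PosDef.one
    · exact h.posDef i hpos hle z

theorem IsMasterSolution.tendsto_donaldsonDist (h : IsMasterSolution hN L q g r Ω)
    (h' : IsMasterSolution hN L q g r Ω') (hN0 : N 0 = 0)
    (hr : ∀ i, 1 ≤ i → i ≤ L → 0 < r i) {i : ℕ} (h1 : 1 ≤ i) (hi : i ≤ L) :
    Tendsto (fun z => donaldsonDist (Ω i z) (Ω' i z)) (cocompact ℂ) (𝓝 0) := by
  have hV := det_vacOmega_ne_zero (r := r) hN0 hN hr i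
  have b := h.boundary i h1 hi
  have b' := h'.boundary i h1 hi
  -- This puts the boundary condition in the form `W Ω Wᴴ` with `W = 𝔇_i⁻¹`.
  simp only [← conjTranspose_nonsing_inv] at b b'
  have := ((tendsto_trace_mul_inv hV b b').add (tendsto_trace_mul_inv hV b' b)).sub
    (tendsto_const_nhds (x := (2 * Fintype.card (Fin (N i)) : ℂ)))
  rw [← two_mul, sub_self] at this
  exact this

/-- The contribution of the link `q_s` to the trace of the equation at the node `s`. -/
def linkLeft (q : (i : ℕ) → ℂ → Matrix (Fin (N i)) (Fin (N (i + 1))) ℂ)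
    (Ω Ω' : (i : ℕ) → ℂ → Matrix (Fin (N i)) (Fin (N i)) ℂ) (z : ℂ) (s : ℕ) : ℂ :=
  ((q s z * Ω (s + 1) z * (q s z)ᴴ * (Ω s z)⁻¹ - q s z * Ω' (s + 1) z * (q s z)ᴴ * (Ω' s z)⁻¹)
    * (Ω s z * (Ω' s z)⁻¹ - Ω' s z * (Ω s z)⁻¹)).trace

/-- The contribution of the link `q_s` to the trace of the equation at the node `s + 1`. -/
def linkRight (q : (i : ℕ) → ℂ → Matrix (Fin (N i)) (Fin (N (i + 1))) ℂ)
    (Ω Ω' : (i : ℕ) → ℂ → Matrix (Fin (N i)) (Fin (N i)) ℂ) (z : ℂ) (s : ℕ) : ℂ :=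
  ((Ω (s + 1) z * (q s z)ᴴ * (Ω s z)⁻¹ * q s z - Ω' (s + 1) z * (q s z)ᴴ * (Ω' s z)⁻¹ * q s z)
    * (Ω (s + 1) z * (Ω' (s + 1) z)⁻¹ - Ω' (s + 1) z * (Ω (s + 1) z)⁻¹)).trace

/-- Subtracting the two master equations cancels the constant `r (s + 1)` and leaves only link
terms. -/
theorem IsMasterSolution.trace_curvature_sub (h : IsMasterSolution hN L q g r Ω)
    (h' : IsMasterSolution hN L q g r Ω') (z : ℂ) {s : ℕ} (hs : s < L) :
    ((4 / g (s + 1) ^ 2 : ℝ) : ℂ)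
        * ((matDzbar (conn (Ω (s + 1))) z - matDzbar (conn (Ω' (s + 1))) z)
          * (Ω (s + 1) z * (Ω' (s + 1) z)⁻¹ - Ω' (s + 1) z * (Ω (s + 1) z)⁻¹)).trace
      = linkRight q Ω Ω' z s - linkLeft q Ω Ω' z (s + 1) := by
  have m := h.master s hs z
  have m' := h'.master s hs z
  change _ = _ - _ • matDzbar (conn (Ω (s + 1))) z at m
  change _ = _ - _ • matDzbar (conn (Ω' (s + 1))) z at m'
  rw [← smul_eq_mul, ← trace_smul, ← Matrix.smul_mul, smul_sub, linkRight, linkLeft, ← trace_sub,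
    ← Matrix.sub_mul]
  congr 2
  rw [eq_sub_iff_add_eq, ← eq_sub_iff_add_eq'] at m m'
  rw [m, m']
  abel

/-- Summation by parts: regrouped by link, each difference `linkRight s - linkLeft s` is
nonnegative. The two extra end terms vanish, since `Ω_{L+1} = Ω'_{L+1}` and node `0` has dimension
zero. -/
theorem IsMasterSolution.sum_trace_curvature_nonneg (h : IsMasterSolution hN L q g r Ω)
    (h' : IsMasterSolution hN L q g r Ω') (hN0 : N 0 = 0) (z : ℂ) :
    0 ≤ ∑ s ∈ Finset.range L, (linkRight q Ω Ω' z s - linkLeft q Ω Ω' z (s + 1)) := by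
  have hlink : 0 ≤ ∑ s ∈ Finset.range (L + 1), (linkRight q Ω Ω' z s - linkLeft q Ω Ω' z s) := by
    refine Finset.sum_nonneg fun s hs => ?_
    have hs : s ≤ L := Nat.lt_succ_iff.1 (Finset.mem_range.1 hs)
    exact link_trace_nonneg (h.posDef_of_le hN0 (by omega) z) (h'.posDef_of_le hN0 (by omega) z)
      (h.posDef_of_le hN0 (by omega) z) (h'.posDef_of_le hN0 (by omega) z) (q s z)
  have hlast : linkRight q Ω Ω' z L = 0 := by
    rw [linkRight, h.last z, h'.last z, sub_self, Matrix.mul_zero, trace_zero]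
  have hfirst : linkLeft q Ω Ω' z 0 = 0 := by
    have : IsEmpty (Fin (N 0)) := by rw [hN0]; infer_instance
    simp [linkLeft, Matrix.trace]
  rw [Finset.sum_sub_distrib, Finset.sum_range_succ, Finset.sum_range_succ', hlast, hfirst] at hlink
  rw [Finset.sum_sub_distrib]
  simpa using hlink

theorem IsMasterSolution.donaldsonDist_eq_zero (h : IsMasterSolution hN L q g r Ω)
    (h' : IsMasterSolution hN L q g r Ω') (hN0 : N 0 = 0)
    (hg : ∀ i, 1 ≤ i → i ≤ L → 0 < g i) (hr : ∀ i, 1 ≤ i → i ≤ L → 0 < r i) {s : ℕ} (hs : s < L)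
    (z : ℂ) : donaldsonDist (Ω (s + 1) z) (Ω' (s + 1) z) = 0 := by
  -- The weight is the coefficient of the curvature in the master equation, so the link terms enter
  -- the sum without coupling constants and can be paired across neighbouring nodes.
  set f : ℕ → ℂ → ℂ := fun s w =>
    ((4 / g (s + 1) ^ 2 : ℝ) : ℂ) * donaldsonDist (Ω (s + 1) w) (Ω' (s + 1) w) with hf_def
  have hw {s : ℕ} (hs : s < L) : (0 : ℂ) < ((4 / g (s + 1) ^ 2 : ℝ) : ℂ) := by
    have := hg (s + 1) (by omega) hs
    exact_mod_cast (by positivity : 0 < 4 / g (s + 1) ^ 2)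
  have hD {s : ℕ} (hs : s < L) :
      ContDiff ℝ ∞ fun w => donaldsonDist (Ω (s + 1) w) (Ω' (s + 1) w) :=
    contDiff_donaldsonDist (h.smooth _ (by omega) hs) (h'.smooth _ (by omega) hs)
      (h.posDef _ (by omega) hs) (h'.posDef _ (by omega) hs)
  have hf {s : ℕ} (hs : s < L) : ContDiff ℝ ∞ (f s) := contDiff_const.mul (hD hs)
  have hf0 {s : ℕ} (hs : s < L) (w : ℂ) : 0 ≤ f s w :=
    mul_nonneg (hw hs).le (donaldsonDist_nonneg (h.posDef _ (by omega) hs w)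
      (h'.posDef _ (by omega) hs w))
  have d {f : ℂ → ℂ} (hf : ContDiff ℝ ∞ f) : Differentiable ℝ f := hf.differentiable (by simp)
  have wirt_const_mul (a c : ℂ) {f : ℂ → ℂ} (hf : ContDiff ℝ ∞ f) :
      wirt c (fun w => a * f w) = fun w => a * wirt c f w := by
    ext w
    rw [wirt_mul (differentiableAt_const a) (d hf w), wirt_const]
    ring
  have hdd (w : ℂ) : dzbar (dz fun w => ∑ s ∈ Finset.range L, f s w) w
      = ∑ s ∈ Finset.range L, ((4 / g (s + 1) ^ 2 : ℝ) : ℂ)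
        * dzbar (dz fun w => donaldsonDist (Ω (s + 1) w) (Ω' (s + 1) w)) w := by
    have e : (dz fun w => ∑ s ∈ Finset.range L, f s w)
        = fun w => ∑ s ∈ Finset.range L, wirt (-Complex.I) (f s) w := by
      ext w
      rw [dz_eq_wirt, wirt_sum _ fun s hs => d (hf (Finset.mem_range.1 hs)) w]
    rw [e, dzbar_eq_wirt, wirt_sum _ fun s hs =>
      d (ContDiff.wirt (hf (Finset.mem_range.1 hs))) w]
    refine Finset.sum_congr rfl fun s hs => ?_
    have hs := Finset.mem_range.1 hs
    rw [wirt_const_mul _ _ (hD hs), wirt_const_mul _ _ (ContDiff.wirt (hD hs)), dz_eq_wirt,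
      dzbar_eq_wirt]
  have hzero : ∑ s ∈ Finset.range L, f s z = 0 := by
    refine eq_zero_of_dzbar_dz_nonneg (f := fun w => ∑ s ∈ Finset.range L, f s w)
      (ContDiff.sum fun s hs => hf (Finset.mem_range.1 hs))
      (fun w => Finset.sum_nonneg fun s hs => hf0 (Finset.mem_range.1 hs) w) (fun w => ?_) ?_ z
    · rw [hdd]
      refine (h.sum_trace_curvature_nonneg h' hN0 w).trans (Finset.sum_le_sum fun s hs => ?_)
      have hs := Finset.mem_range.1 hs
      rw [← h.trace_curvature_sub h' w hs]
      exact mul_le_mul_of_nonneg_left (le_dzbar_dz_donaldsonDist (h.smooth _ (by omega) hs)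
        (h'.smooth _ (by omega) hs) (h.posDef _ (by omega) hs) (h'.posDef _ (by omega) hs) w)
        (hw hs).le
    · rw [← Finset.sum_const_zero (s := Finset.range L)]
      refine tendsto_finsetSum _ fun s hs => ?_
      have hs := Finset.mem_range.1 hs
      simpa only [hf_def, mul_zero] using
        (h.tendsto_donaldsonDist h' hN0 hr (i := s + 1) (by omega) hs).const_mul
          ((4 / g (s + 1) ^ 2 : ℝ) : ℂ)
  have := (Finset.sum_eq_zero_iff_of_nonneg fun s hs => hf0 (Finset.mem_range.1 hs) z).1 hzero s
    (Finset.mem_range.2 hs)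
  exact (mul_eq_zero.1 this).resolve_left (hw hs).ne'

end Uniqueness

end VortexMaster

end

theorem mainTheorem7 (L : ℕ) (N : ℕ → ℕ) (hN0 : N 0 = 0) (hN : Monotone N)
    (q : (i : ℕ) → ℂ → Matrix (Fin (N i)) (Fin (N (i + 1))) ℂ)
    (hq : ∀ i, 1 ≤ i → i ≤ L → ∀ a b, Differentiable ℂ (fun z => q i z a b))
    (g r : ℕ → ℝ) (hg : ∀ i, 1 ≤ i → i ≤ L → 0 < g i) (hr : ∀ i, 1 ≤ i → i ≤ L → 0 < r i)
    (Ω Ω' : (i : ℕ) → ℂ → Matrix (Fin (N i)) (Fin (N i)) ℂ)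
    (hΩ : VortexMaster.IsMasterSolution hN L q g r Ω)
    (hΩ' : VortexMaster.IsMasterSolution hN L q g r Ω') :
    ∀ i, 1 ≤ i → i ≤ L → ∀ z, Ω i z = Ω' i z := by
  intro i h1 hi z
  obtain ⟨s, rfl⟩ := Nat.exists_eq_add_of_le' h1
  exact VortexMaster.eq_of_donaldsonDist_eq_zero (hΩ.posDef _ h1 hi z) (hΩ'.posDef _ h1 hi z)
    (hΩ.donaldsonDist_eq_zero hΩ' hN0 hg hr hi z)
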